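/- **Game.** Let $A^1,A^2$ be nonempty finite sets of actions and $S^1,S^2$ finite sets of signals. Put $H_n=(A^1\times A^2)^n$, $H=\bigcup_{n\ge 0}H_n$ and $\widetilde H=(A^1\times A^2)^{\mathbb N}$. An *incomplete-information Pursuit-Evasion Game* $G$ is given by a daily payoff function $f:H\to[0,\infty)$ and, for each $h\in H$, probability distributions $p^1_h\in\Delta(S^1)$ and $p^2_h\in\Delta(S^2)$. Its payoff function is $\rho:\widetilde H\to[0,\infty]$, $\rho(h)=\sum_{n=0}^\infty f(h_n)$, where $h_n$ is the prefix of $h$ of length $n$. The game is *bounded* if there is a real $B$ with $\rho(h)<B$ for all $h\in\widetilde H$. A (behavioral) *strategy* of player $i$ is a function $\sigma^i:\bigcup_{n\ge0}(A^i\times S^i)^n\to\Delta(A^i)$. The game is played in stages $n=0,1,2,\dots$. At stage $n$, with current history $h_n$ (and $h_0=\emptyset$), the players draw actions $a\in A^1$ and $b\in A^2$ independently, each according to his strategy at the sequence of his own past actions and signals. The history becomes $h_{n+1}=h_n\frown(a,b)$. A signal pair $(s^1,s^2)$ is then drawn with law $p^1_{h_{n+1}}\times p^2_{h_{n+1}}$,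 and player $i$ observes $s^i$ only. A profile $(\sigma^1,\sigma^2)$ thus induces a probability measure $\mu_{\sigma^1,\sigma^2}$ on $\widetilde H$. Player 1, the Maximizer, wants to maximize the expectation of $\rho$; player 2, the Minimizer, wants to minimize it. **Values.** Put $\mathrm{val}_G(\sigma^1)=\inf_{\sigma^2}E_{\mu_{\sigma^1,\sigma^2}}(\rho)$ and $\mathrm{val}_G(\sigma^2)=\sup_{\sigma^1}E_{\mu_{\sigma^1,\sigma^2}}(\rho)$. The game has the *value* $\mathrm{val}(G)$ if $\sup_{\sigma^1}\mathrm{val}_G(\sigma^1)=\inf_{\sigma^2}\mathrm{val}_G(\sigma^2)=\mathrm{val}(G)$. In a game with a value, a strategy $\sigma^i$ is *$\epsilon$-optimal* if $|\mathrm{val}_G(\sigma^i)-\mathrm{val}(G)|<\epsilon$, and *optimal* if $\mathrm{val}_G(\sigma^i)=\mathrm{val}(G)$. Let $G_n$ be the game obtained from $G$ by replacing $f$ by $0$ at all histories of length larger than $n$. The game $G$ has a *uniform value* if it has a value and for each $\epsilon>0$ there exist $N$ and strategies $\sigma^1,\sigma^2$ of the two players such that, for every $n>N$, the game $G_n$ has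 a value and both $\sigma^1$ and $\sigma^2$ are $\epsilon$-optimal in $G_n$. **Theorem 1.** Every bounded incomplete-information Pursuit-Evasion Game with finite action sets and finite signal sets has a uniform value. Furthermore, the Minimizer has an optimal strategy in $G$. -/

import Mathlib

open MeasureTheory ProbabilityTheory
open scoped NNReal ENNReal

noncomputable section

namespace PursuitEvasion

/-- The data of a two-player zero-sum cumulative game with incomplete information and
nonnegative daily payoffs. Player 1 is the Maximizer, with actions `A₁` and signals `S₁`;
player 2 is the Minimizer, with actions `A₂` and signals `S₂`. A history of length `n` is an
element of `Fin n → A₁ × A₂`. -/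
structure Game (A₁ A₂ S₁ S₂ : Type*) where
  /-- the nonnegative daily payoff attached to every finite history -/
  payoff : (n : ℕ) → (Fin n → A₁ × A₂) → ℝ≥0
  /-- the law of the signal sent to the Maximizer when the current history is `h` -/
  signal₁ : (n : ℕ) → (Fin n → A₁ × A₂) → PMF S₁
  /-- the law of the signal sent to the Minimizer when the current history is `h` -/
  signal₂ : (n : ℕ) → (Fin n → A₁ × A₂) → PMF S₂

/-- Behavioral strategies of a player with actions `A` and signals `S`: a mixed action for each
finite private history, that is, for each finite sequence of own actions and own signals. -/
abbrev Strategy (A S : Type*) := (n : ℕ) → (Fin n → A × S) → PMF A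

namespace Game

variable {A₁ A₂ S₁ S₂ : Type*}

/-- The payoff `ρ(h) = ∑ₙ f(hₙ)` of an infinite history, `hₙ` being its prefix of length `n`. -/
def totalPayoff (G : Game A₁ A₂ S₁ S₂) (h : ℕ → A₁ × A₂) : ℝ≥0∞ :=
  ∑' n : ℕ, (G.payoff n (fun i : Fin n => h i) : ℝ≥0∞)

/-- The game is bounded if its payoff function is. -/
def Bounded (G : Game A₁ A₂ S₁ S₂) : Prop :=
  ∃ B : ℝ≥0, ∀ h : ℕ → A₁ × A₂, G.totalPayoff h < B

/-- The truncated game `Gₙ`: daily payoffs at histories of length larger than `n` are replaced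
by zero. -/
def truncate (G : Game A₁ A₂ S₁ S₂) (n : ℕ) : Game A₁ A₂ S₁ S₂ where
  payoff k h := if k ≤ n then G.payoff k h else 0
  signal₁ := G.signal₁
  signal₂ := G.signal₂

/-- The law of the actions and signals of stage `n`, given all actions and signals of the
stages before `n`: the players draw actions `a`, `b` independently according to their private
histories, the history is extended by `(a, b)`, and then the signals are drawn independently,
with laws determined by the extended history. -/
def stageLaw (G : Game A₁ A₂ S₁ S₂) (σ : Strategy A₁ S₁) (τ : Strategy A₂ S₂) (n : ℕ)
    (x : Fin n → (A₁ × S₁) × (A₂ × S₂)) : PMF ((A₁ × S₁) × (A₂ × S₂)) :=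
  (σ n fun i => (x i).1).bind fun a =>
  (τ n fun i => (x i).2).bind fun b =>
  (G.signal₁ (n + 1)
    (Fin.snoc (α := fun _ => A₁ × A₂) (fun i => ((x i).1.1, (x i).2.1)) (a, b))).bind fun s =>
  (G.signal₂ (n + 1)
    (Fin.snoc (α := fun _ => A₁ × A₂) (fun i => ((x i).1.1, (x i).2.1)) (a, b))).bind fun t =>
  PMF.pure ((a, s), (b, t))

variable [Finite A₁] [Finite A₂] [Finite S₁] [Finite S₂]
  [MeasurableSpace A₁] [MeasurableSpace A₂] [MeasurableSpace S₁] [MeasurableSpace S₂]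
  [DiscreteMeasurableSpace A₁] [DiscreteMeasurableSpace A₂]
  [DiscreteMeasurableSpace S₁] [DiscreteMeasurableSpace S₂]

/-- The transition kernel from the stages `0, …, n` to the stage `n + 1`. -/
def stageKernel (G : Game A₁ A₂ S₁ S₂) (σ : Strategy A₁ S₁) (τ : Strategy A₂ S₂) (n : ℕ) :
    Kernel ((i : Finset.Iic n) → (A₁ × S₁) × (A₂ × S₂)) ((A₁ × S₁) × (A₂ × S₂)) :=
  Kernel.ofFunOfCountable fun x =>
    (G.stageLaw σ τ (n + 1) fun i =>
      x ⟨(i : ℕ), Finset.mem_Iic.2 (Nat.lt_succ_iff.1 i.isLt)⟩).toMeasure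

instance (G : Game A₁ A₂ S₁ S₂) (σ : Strategy A₁ S₁) (τ : Strategy A₂ S₂) (n : ℕ) :
    IsMarkovKernel (G.stageKernel σ τ n) :=
  ⟨fun _ => PMF.toMeasure.isProbabilityMeasure _⟩

/-- The law of the whole play (all actions and all signals) under a profile. -/
def playMeasure (G : Game A₁ A₂ S₁ S₂) (σ : Strategy A₁ S₁) (τ : Strategy A₂ S₂) :
    Measure (ℕ → (A₁ × S₁) × (A₂ × S₂)) :=
  Kernel.trajMeasure (X := fun _ => (A₁ × S₁) × (A₂ × S₂))
    (G.stageLaw σ τ 0 Fin.elim0).toMeasure (G.stageKernel σ τ)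

/-- The law of the infinite history (all actions) under a profile. -/
def historyMeasure (G : Game A₁ A₂ S₁ S₂) (σ : Strategy A₁ S₁) (τ : Strategy A₂ S₂) :
    Measure (ℕ → A₁ × A₂) :=
  (G.playMeasure σ τ).map fun x n => ((x n).1.1, (x n).2.1)

/-- The expected payoff under a profile. -/
def expectedPayoff (G : Game A₁ A₂ S₁ S₂) (σ : Strategy A₁ S₁) (τ : Strategy A₂ S₂) : ℝ≥0∞ :=
  ∫⁻ h, G.totalPayoff h ∂(G.historyMeasure σ τ)

/-- The value of a strategy of the Maximizer. -/
def val₁ (G : Game A₁ A₂ S₁ S₂) (σ : Strategy A₁ S₁) : ℝ≥0∞ :=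
  ⨅ τ : Strategy A₂ S₂, G.expectedPayoff σ τ

/-- The value of a strategy of the Minimizer. -/
def val₂ (G : Game A₁ A₂ S₁ S₂) (τ : Strategy A₂ S₂) : ℝ≥0∞ :=
  ⨆ σ : Strategy A₁ S₁, G.expectedPayoff σ τ

/-- The lower value of the game. -/
def lowerValue (G : Game A₁ A₂ S₁ S₂) : ℝ≥0∞ := ⨆ σ : Strategy A₁ S₁, G.val₁ σ

/-- The upper value of the game. -/
def upperValue (G : Game A₁ A₂ S₁ S₂) : ℝ≥0∞ := ⨅ τ : Strategy A₂ S₂, G.val₂ τ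

/-- `v` is the value of the game: the lower and the upper value both equal `v`. -/
def IsValue (G : Game A₁ A₂ S₁ S₂) (v : ℝ≥0∞) : Prop := G.lowerValue = v ∧ G.upperValue = v

/-- `σ` is an `ε`-optimal strategy of the Maximizer: the game has a value `v`, and
`|val(σ) - v| < ε`. (The absolute value is spelled out because the numbers are in `[0, ∞]`.) -/
def IsEpsOptimal₁ (G : Game A₁ A₂ S₁ S₂) (ε : ℝ≥0) (σ : Strategy A₁ S₁) : Prop :=
  ∃ v, G.IsValue v ∧ G.val₁ σ < v + ε ∧ v < G.val₁ σ + ε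

/-- `τ` is an `ε`-optimal strategy of the Minimizer: the game has a value `v`, and
`|val(τ) - v| < ε`. -/
def IsEpsOptimal₂ (G : Game A₁ A₂ S₁ S₂) (ε : ℝ≥0) (τ : Strategy A₂ S₂) : Prop :=
  ∃ v, G.IsValue v ∧ G.val₂ τ < v + ε ∧ v < G.val₂ τ + ε

/-- `τ` is an optimal strategy of the Minimizer: the game has a value, and `val(τ)` equals it. -/
def IsOptimal₂ (G : Game A₁ A₂ S₁ S₂) (τ : Strategy A₂ S₂) : Prop := G.IsValue (G.val₂ τ)

/-- The game has a uniform value: it has a value, and for each `ε > 0` there are `N` and two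
strategies that are `ε`-optimal in every truncated game `Gₙ` with `n > N`. -/
def HasUniformValue (G : Game A₁ A₂ S₁ S₂) : Prop :=
  (∃ v, G.IsValue v) ∧
  ∀ ε : ℝ≥0, 0 < ε → ∃ (N : ℕ) (σ : Strategy A₁ S₁) (τ : Strategy A₂ S₂),
    ∀ n > N, (G.truncate n).IsEpsOptimal₁ ε σ ∧ (G.truncate n).IsEpsOptimal₂ ε τ

end Game

end PursuitEvasion

end

/-!
A behavioral strategy is encoded by its realization plan, which gives to each private history the
product of the probabilities of its actions. Realization plans form a compact convex set on which
the payoff of a truncated game is bilinear and continuous, so Sion's theorem provides optimal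
strategies in every `Gₙ`. By monotone convergence `E ρ` is the increasing limit of the payoffs of
the `Gₙ`; hence the values `vₙ` of the `Gₙ` increase to some `v`, which the Maximizer guarantees
up to `ε` by an optimal strategy of some `G_N`. For each `n`, the plans of the Minimizer that
guarantee `v` in `Gₙ` form a nonempty compact set, decreasing in `n`; a common element is optimal
in `G`.
-/

noncomputable section

namespace PursuitEvasion

section Topology

lemma exists_forall_le_of_monotone_of_lowerSemicontinuous {ι X γ : Type*} [Preorder ι]
    [IsDirectedOrder ι] [Nonempty ι] [TopologicalSpace X] [CompactSpace X] [LinearOrder γ]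
    {F : ι → X → γ} (hmono : Monotone F) (hF : ∀ i, LowerSemicontinuous (F i)) {c : γ}
    (h : ∀ i, ∃ x, F i x ≤ c) : ∃ x, ∀ i, F i x ≤ c := by
  have hclosed (i : ι) : IsClosed (F i ⁻¹' Set.Iic c) :=
    lowerSemicontinuous_iff_isClosed_preimage.1 (hF i) c
  have hanti : Antitone fun i => F i ⁻¹' Set.Iic c := fun _ _ hij x hx => (hmono hij x).trans hx
  obtain ⟨x, hx⟩ := IsCompact.nonempty_iInter_of_directed_nonempty_isCompact_isClosed
    (fun i => F i ⁻¹' Set.Iic c) hanti.directed_ge h (fun i => (hclosed i).isCompact) hclosed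
  exact ⟨x, fun i => Set.mem_iInter.1 hx i⟩

lemma exists_isSaddlePointOn_of_bilinear {E F : Type*}
    [TopologicalSpace E] [AddCommGroup E] [Module ℝ E] [IsTopologicalAddGroup E]
    [ContinuousSMul ℝ E] [TopologicalSpace F] [AddCommGroup F] [Module ℝ F]
    [IsTopologicalAddGroup F] [ContinuousSMul ℝ F] {X : Set E} {Y : Set F}
    (hX : X.Nonempty) (hXc : Convex ℝ X) (hXk : IsCompact X)
    (hY : Y.Nonempty) (hYc : Convex ℝ Y) (hYk : IsCompact Y) (b : E →ₗ[ℝ] F →ₗ[ℝ] ℝ)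
    (hbl : ∀ y, Continuous fun x => b x y) (hbr : ∀ x, Continuous (b x)) :
    ∃ x ∈ X, ∃ y ∈ Y, IsSaddlePointOn X Y (fun x y => b x y) x y :=
  Sion.exists_isSaddlePointOn hX hXc hXk
    (fun y _ => (hbl y).lowerSemicontinuous.lowerSemicontinuousOn X)
    (fun y _ => ((b.flip y).convexOn hXc).quasiconvexOn) hYc hY hYk
    (fun x _ => (hbr x).upperSemicontinuous.upperSemicontinuousOn Y)
    (fun x _ => ((b x).concaveOn hYc).quasiconcaveOn)

end Topology

section Trajectory

open PiNat Preorder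

lemma cylinder_succ_eq_preimage_frestrictLe {X : ℕ → Type*} (x : (n : ℕ) → X n) (n : ℕ) :
    cylinder x (n + 1) = frestrictLe n ⁻¹' {frestrictLe n x} := by
  ext y
  simp [funext_iff]

lemma cylinder_succ_succ_eq_preimage_prod {X : ℕ → Type*} (x : (n : ℕ) → X n) (n : ℕ) :
    cylinder x (n + 2) =
      (fun y => (frestrictLe n y, y (n + 1))) ⁻¹' ({frestrictLe n x} ×ˢ {x (n + 1)}) := by
  ext y
  simp [funext_iff, Nat.lt_succ_iff, Nat.le_succ_iff, or_imp, forall_and]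

variable {X : ℕ → Type*} [∀ n, MeasurableSpace (X n)] [∀ n, MeasurableSingletonClass (X n)]
  (μ₀ : Measure (X 0))
  (κ : (n : ℕ) → Kernel ((i : Finset.Iic n) → X i) (X (n + 1))) [∀ n, IsMarkovKernel (κ n)]

lemma trajMeasure_cylinder_one (x : (n : ℕ) → X n) :
    Kernel.trajMeasure μ₀ κ (cylinder x 1) = μ₀ {x 0} := by
  rw [cylinder_succ_eq_preimage_frestrictLe,
    ← Measure.map_apply (by fun_prop) (.singleton _), Kernel.trajMeasure,
    Measure.map_comp _ _ (by fun_prop), Kernel.traj_map_frestrictLe, Kernel.partialTraj_self,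
    Measure.id_comp]
  refine (Measure.map_apply (MeasurableEquiv.measurable _) (.singleton _)).trans
    (congrArg μ₀ (Set.ext fun z => ?_))
  exact (MeasurableEquiv.piUnique fun i : Finset.Iic 0 => X i).toEquiv.symm_apply_eq

lemma trajMeasure_cylinder_succ_succ [IsProbabilityMeasure μ₀] (x : (n : ℕ) → X n) (n : ℕ) :
    Kernel.trajMeasure μ₀ κ (cylinder x (n + 2)) =
      Kernel.trajMeasure μ₀ κ (cylinder x (n + 1)) * κ n (frestrictLe n x) {x (n + 1)} := by
  rw [cylinder_succ_succ_eq_preimage_prod, cylinder_succ_eq_preimage_frestrictLe,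
    ← Measure.map_apply (by fun_prop) ((MeasurableSet.singleton _).prod (.singleton _)),
    ← Measure.map_apply (by fun_prop) (.singleton _),
    ← Kernel.map_frestrictLe_trajMeasure_compProd_eq_map_trajMeasure,
    Measure.compProd_apply_prod (.singleton _) (.singleton _), Measure.restrict_singleton,
    lintegral_smul_measure, lintegral_dirac, smul_eq_mul]

lemma lintegral_prefix {Z : Type*} [Fintype Z] [MeasurableSpace Z] [MeasurableSingletonClass Z]
    (μ : Measure (ℕ → Z)) (k : ℕ) (f : (Fin k → Z) → ℝ≥0∞) :
    ∫⁻ y, f (fun i => y i) ∂μ = ∑ z, f z * μ {y | ∀ i : Fin k, y i = z i} := by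
  have hprefix : Measurable fun (y : ℕ → Z) (i : Fin k) => y i := by fun_prop
  rw [← lintegral_map (measurable_of_countable f) hprefix, lintegral_fintype]
  refine Finset.sum_congr rfl fun z _ => ?_
  rw [Measure.map_apply hprefix (.singleton z)]
  simp only [Set.preimage, Set.mem_singleton_iff, funext_iff]

end Trajectory

section RealizationPlan

variable {A S : Type*}

/-- The realization weight of a private history under a strategy: the product of the
probabilities with which the strategy chooses the actions of the history. -/
def weight (σ : Strategy A S) : (n : ℕ) → (Fin n → A × S) → ℝ
  | 0, _ => 1
  | n + 1, h => weight σ n (Fin.init h) * (σ n (Fin.init h) (h (Fin.last n)).1).toReal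

/-- The private history `h` followed by the action `a` and the signal `s`. -/
def extend {n : ℕ} (h : Fin n → A × S) (a : A) (s : S) : Fin (n + 1) → A × S :=
  Fin.snoc (α := fun _ => A × S) h (a, s)

lemma extend_init_last {n : ℕ} (h : Fin (n + 1) → A × S) :
    extend (Fin.init h) (h (Fin.last n)).1 (h (Fin.last n)).2 = h :=
  Fin.snoc_init_self (α := fun _ => A × S) h

lemma weight_extend (σ : Strategy A S) {n : ℕ} (h : Fin n → A × S) (a : A) (s : S) :
    weight σ (n + 1) (extend h a s) = weight σ n h * (σ n h a).toReal := by
  simp [weight, extend]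

lemma weight_nonneg (σ : Strategy A S) (n : ℕ) (h : Fin n → A × S) : 0 ≤ weight σ n h := by
  induction n with
  | zero => exact zero_le_one
  | succ n ih => exact mul_nonneg (ih _) ENNReal.toReal_nonneg

variable [Fintype A]

lemma sum_pmf_toReal_eq_one (p : PMF A) : ∑ a, (p a).toReal = 1 := by
  rw [← ENNReal.toReal_sum fun a _ => p.apply_ne_top a, ← tsum_fintype (L := .unconditional A),
    p.tsum_coe, ENNReal.toReal_one]

lemma exists_pmf_toReal_eq {f : A → ℝ} (hf : ∀ a, 0 ≤ f a) (hsum : ∑ a, f a = 1) :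
    ∃ p : PMF A, ∀ a, (p a).toReal = f a := by
  refine ⟨PMF.ofFintype (fun a => ENNReal.ofReal (f a)) ?_, fun a => ?_⟩
  · rw [← ENNReal.ofReal_sum_of_nonneg fun a _ => hf a, hsum, ENNReal.ofReal_one]
  · rw [PMF.ofFintype_apply, ENNReal.toReal_ofReal (hf a)]

variable (A S) in
/-- The realization plans of a player, described by the linear constraints of the sequence form.
The last constraint says that the weight of a private history does not depend on its last signal,
since this signal is drawn after the last action. -/
def realizationPlans : Set ((n : ℕ) → (Fin n → A × S) → ℝ) :=
  {w | (∀ n h, 0 ≤ w n h) ∧ (∀ h, w 0 h = 1) ∧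
    (∀ n h s, ∑ a, w (n + 1) (extend h a s) = w n h) ∧
    ∀ n h a s s', w (n + 1) (extend h a s) = w (n + 1) (extend h a s')}

lemma weight_mem_realizationPlans (σ : Strategy A S) : weight σ ∈ realizationPlans A S := by
  refine ⟨weight_nonneg σ, fun _ => rfl, fun n h s => ?_, fun n h a s s' => ?_⟩
  · simp_rw [weight_extend, ← Finset.mul_sum, sum_pmf_toReal_eq_one, mul_one]
  · simp_rw [weight_extend]

lemma exists_pmf_extend_eq [Nonempty A] {w : (n : ℕ) → (Fin n → A × S) → ℝ}
    (hw : w ∈ realizationPlans A S) (n : ℕ) (h : Fin n → A × S) :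
    ∃ p : PMF A, ∀ a s, w (n + 1) (extend h a s) = w n h * (p a).toReal := by
  obtain ⟨nonneg, -, sum_extend, extend_signal⟩ := hw
  rcases isEmpty_or_nonempty S with hS | ⟨⟨s₀⟩⟩
  · exact ⟨PMF.pure (Classical.arbitrary A), fun _ => isEmptyElim⟩
  rcases eq_or_ne (w n h) 0 with hz | hz
  · refine ⟨PMF.pure (Classical.arbitrary A), fun a s => ?_⟩
    rw [hz, zero_mul]
    exact (Finset.sum_eq_zero_iff_of_nonneg fun a _ => nonneg _ _).1
      ((sum_extend n h s).trans hz) a (Finset.mem_univ a)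
  · obtain ⟨p, hp⟩ := exists_pmf_toReal_eq (f := fun a => w (n + 1) (extend h a s₀) / w n h)
      (fun a => div_nonneg (nonneg _ _) (nonneg _ _))
      (by rw [← Finset.sum_div, sum_extend, div_self hz])
    refine ⟨p, fun a s => ?_⟩
    rw [hp, mul_div_cancel₀ _ hz, extend_signal n h a s s₀]

lemma exists_weight_eq [Nonempty A] {w : (n : ℕ) → (Fin n → A × S) → ℝ}
    (hw : w ∈ realizationPlans A S) : ∃ σ : Strategy A S, weight σ = w := by
  choose σ hσ using exists_pmf_extend_eq hw
  refine ⟨σ, funext fun n => ?_⟩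
  induction n with
  | zero => exact funext fun h => (hw.2.1 h).symm
  | succ n ih =>
    funext h
    rw [← extend_init_last h, weight_extend, hσ, ih]

lemma le_one_of_mem_realizationPlans {w : (n : ℕ) → (Fin n → A × S) → ℝ}
    (hw : w ∈ realizationPlans A S) (n : ℕ) (h : Fin n → A × S) : w n h ≤ 1 := by
  obtain ⟨nonneg, root, sum_extend, -⟩ := hw
  induction n with
  | zero => exact (root h).le
  | succ n ih =>
    set h' := Fin.init h
    set s := (h (Fin.last n)).2
    calc w (n + 1) h = w (n + 1) (extend h' (h (Fin.last n)).1 s) := by rw [extend_init_last]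
      _ ≤ ∑ a, w (n + 1) (extend h' a s) :=
        Finset.single_le_sum (f := fun a => w (n + 1) (extend h' a s))
          (fun _ _ => nonneg _ _) (Finset.mem_univ _)
      _ = w n h' := sum_extend n h' s
      _ ≤ 1 := ih h'

lemma isClosed_realizationPlans : IsClosed (realizationPlans A S) := by
  simp only [realizationPlans, Set.ofPred_and, Set.ofPred_forall]
  refine .inter ?_ (.inter ?_ (.inter ?_ ?_))
  · exact isClosed_iInter fun n => isClosed_iInter fun h =>
      isClosed_le continuous_const (by fun_prop)
  · exact isClosed_iInter fun h => isClosed_eq (by fun_prop) continuous_const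
  · exact isClosed_iInter fun n => isClosed_iInter fun h => isClosed_iInter fun s =>
      isClosed_eq (by fun_prop) (by fun_prop)
  · exact isClosed_iInter fun n => isClosed_iInter fun h => isClosed_iInter fun a =>
      isClosed_iInter fun s => isClosed_iInter fun s' => isClosed_eq (by fun_prop) (by fun_prop)

lemma isCompact_realizationPlans : IsCompact (realizationPlans A S) := by
  have hbox : IsCompact (Set.univ.pi fun n => Set.univ.pi fun _ : Fin n → A × S =>
      Set.Icc (0 : ℝ) 1) :=
    isCompact_univ_pi fun _ => isCompact_univ_pi fun _ => isCompact_Icc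
  exact hbox.of_isClosed_subset isClosed_realizationPlans fun w hw n _ h _ =>
    ⟨hw.1 n h, le_one_of_mem_realizationPlans hw n h⟩

lemma convex_realizationPlans : Convex ℝ (realizationPlans A S) := by
  rintro v ⟨v_nonneg, v_root, v_sum, v_signal⟩ w ⟨w_nonneg, w_root, w_sum, w_signal⟩ a b ha hb hab
  refine ⟨fun n h => ?_, fun h => ?_, fun n h s => ?_, fun n h c s s' => ?_⟩
  · exact add_nonneg (mul_nonneg ha (v_nonneg n h)) (mul_nonneg hb (w_nonneg n h))
  · simp [v_root, w_root, hab]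
  · simp [Finset.sum_add_distrib, ← Finset.mul_sum, v_sum, w_sum]
  · simp [v_signal n h c s s', w_signal n h c s s']

lemma realizationPlans_nonempty [Nonempty A] : (realizationPlans A S).Nonempty :=
  ⟨_, weight_mem_realizationPlans fun _ _ => PMF.pure (Classical.arbitrary A)⟩

end RealizationPlan

namespace Game

variable {A₁ A₂ S₁ S₂ : Type*}

section Truncation

lemma totalPayoff_truncate (G : Game A₁ A₂ S₁ S₂) (n : ℕ) (h : ℕ → A₁ × A₂) :
    (G.truncate n).totalPayoff h =
      ∑ k ∈ Finset.range (n + 1), (G.payoff k (fun i => h i) : ℝ≥0∞) := by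
  rw [totalPayoff, tsum_eq_sum (s := Finset.range (n + 1))]
  · exact Finset.sum_congr rfl fun k hk => by
      simp [truncate, Nat.lt_succ_iff.1 (Finset.mem_range.1 hk)]
  · intro k hk
    simp [truncate, mt Nat.lt_succ_iff.2 (mt Finset.mem_range.2 hk)]

lemma totalPayoff_truncate_mono (G : Game A₁ A₂ S₁ S₂) :
    Monotone fun n => (G.truncate n).totalPayoff := by
  intro m n hmn h
  simp only [totalPayoff_truncate]
  gcongr

lemma totalPayoff_eq_iSup_truncate (G : Game A₁ A₂ S₁ S₂) (h : ℕ → A₁ × A₂) :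
    G.totalPayoff h = ⨆ n, (G.truncate n).totalPayoff h := by
  simp only [totalPayoff_truncate]
  exact ENNReal.tsum_eq_iSup_nat' (Filter.tendsto_add_atTop_nat 1)

end Truncation

section Measurability

variable [Finite A₁] [Finite A₂] [MeasurableSpace A₁] [MeasurableSpace A₂]
  [DiscreteMeasurableSpace A₁] [DiscreteMeasurableSpace A₂]

lemma measurable_payoff_prefix (G : Game A₁ A₂ S₁ S₂) (k : ℕ) :
    Measurable fun h : ℕ → A₁ × A₂ => (G.payoff k (fun i => h i) : ℝ≥0∞) :=
  (measurable_of_countable fun z : Fin k → A₁ × A₂ => (G.payoff k z : ℝ≥0∞)).comp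
    (by fun_prop)

lemma measurable_totalPayoff (G : Game A₁ A₂ S₁ S₂) : Measurable G.totalPayoff :=
  Measurable.tsum G.measurable_payoff_prefix

end Measurability

/-- The pair of actions in the record `((a, s), (b, t))` of a stage. -/
def actionPair (z : (A₁ × S₁) × (A₂ × S₂)) : A₁ × A₂ := (z.1.1, z.2.1)

/-- The product of the probabilities of the signals in a sequence of stages, which is the factor
of the probability of this sequence that does not depend on the strategies. -/
def signalWeight (G : Game A₁ A₂ S₁ S₂) : (n : ℕ) → (Fin n → (A₁ × S₁) × (A₂ × S₂)) → ℝ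
  | 0, _ => 1
  | n + 1, x => signalWeight G n (Fin.init x) *
      ((G.signal₁ (n + 1) (fun i => actionPair (x i)) (x (Fin.last n)).1.2).toReal *
        (G.signal₂ (n + 1) (fun i => actionPair (x i)) (x (Fin.last n)).2.2).toReal)

lemma signalWeight_nonneg (G : Game A₁ A₂ S₁ S₂) (n : ℕ)
    (x : Fin n → (A₁ × S₁) × (A₂ × S₂)) : 0 ≤ G.signalWeight n x := by
  induction n with
  | zero => exact zero_le_one
  | succ n ih =>
    exact mul_nonneg (ih _) (mul_nonneg ENNReal.toReal_nonneg ENNReal.toReal_nonneg)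

lemma stageLaw_apply (G : Game A₁ A₂ S₁ S₂) (σ : Strategy A₁ S₁) (τ : Strategy A₂ S₂) (n : ℕ)
    (x : ℕ → (A₁ × S₁) × (A₂ × S₂)) :
    G.stageLaw σ τ n (fun i => x i) (x n) =
      σ n (fun i => (x i).1) (x n).1.1 * (τ n (fun i => (x i).2) (x n).2.1 *
        (G.signal₁ (n + 1) (fun i => actionPair (x i)) (x n).1.2 *
          G.signal₂ (n + 1) (fun i => actionPair (x i)) (x n).2.2)) := by
  classical
  have hsnoc : (Fin.snoc (α := fun _ => A₁ × A₂) (fun i : Fin n => ((x i).1.1, (x i).2.1))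
      ((x n).1.1, (x n).2.1)) = fun i : Fin (n + 1) => actionPair (x i) :=
    Fin.snoc_init_self (α := fun _ => A₁ × A₂) fun i : Fin (n + 1) => actionPair (x i)
  rw [← hsnoc]
  obtain ⟨⟨a, s⟩, b, t⟩ := x n
  simp only [stageLaw, PMF.bind_apply, PMF.pure_apply, Prod.mk.injEq]
  rw [tsum_eq_single a, tsum_eq_single b, tsum_eq_single s, tsum_eq_single t]
  · simp
  · intro t' ht; simp [ht.symm]
  · intro s' hs; simp [hs.symm]
  · intro b' hb; simp [hb.symm]
  · intro a' ha; simp [ha.symm]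

section PlanPayoff

variable [Fintype A₁] [Fintype A₂] [Fintype S₁] [Fintype S₂]

/-- The expected payoff of stage `k` as a bilinear function of the realization plans. -/
def planPayoff (G : Game A₁ A₂ S₁ S₂) (k : ℕ) :
    ((n : ℕ) → (Fin n → A₁ × S₁) → ℝ) →ₗ[ℝ] ((n : ℕ) → (Fin n → A₂ × S₂) → ℝ) →ₗ[ℝ] ℝ :=
  ∑ x : Fin k → (A₁ × S₁) × (A₂ × S₂),
    (G.payoff k (fun i => actionPair (x i)) * G.signalWeight k x) •
      (LinearMap.mul ℝ ℝ).compl₁₂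
        (LinearMap.proj (fun i => (x i).1) ∘ₗ LinearMap.proj k)
        (LinearMap.proj (fun i => (x i).2) ∘ₗ LinearMap.proj k)

lemma planPayoff_apply (G : Game A₁ A₂ S₁ S₂) (k : ℕ) (v : (n : ℕ) → (Fin n → A₁ × S₁) → ℝ)
    (w : (n : ℕ) → (Fin n → A₂ × S₂) → ℝ) :
    G.planPayoff k v w = ∑ x : Fin k → (A₁ × S₁) × (A₂ × S₂),
      G.payoff k (fun i => actionPair (x i)) *
        (v k (fun i => (x i).1) * w k (fun i => (x i).2) * G.signalWeight k x) := by
  simp only [planPayoff, LinearMap.sum_apply, LinearMap.smul_apply, LinearMap.compl₁₂_apply,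
    LinearMap.comp_apply, LinearMap.proj_apply, LinearMap.mul_apply', smul_eq_mul]
  exact Finset.sum_congr rfl fun x _ => by ring

lemma planPayoff_weight_nonneg (G : Game A₁ A₂ S₁ S₂) (k : ℕ) (σ : Strategy A₁ S₁)
    (τ : Strategy A₂ S₂) : 0 ≤ G.planPayoff k (weight σ) (weight τ) := by
  rw [planPayoff_apply]
  exact Finset.sum_nonneg fun x _ => mul_nonneg (NNReal.coe_nonneg _)
    (mul_nonneg (mul_nonneg (weight_nonneg σ _ _) (weight_nonneg τ _ _))
      (G.signalWeight_nonneg k x))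

/-- The expected payoff in the truncated game `Gₙ` as a bilinear function of the realization
plans. -/
def planSum (G : Game A₁ A₂ S₁ S₂) (n : ℕ) :
    ((n : ℕ) → (Fin n → A₁ × S₁) → ℝ) →ₗ[ℝ] ((n : ℕ) → (Fin n → A₂ × S₂) → ℝ) →ₗ[ℝ] ℝ :=
  ∑ k ∈ Finset.range (n + 1), G.planPayoff k

lemma planSum_apply (G : Game A₁ A₂ S₁ S₂) (n : ℕ) (v : (n : ℕ) → (Fin n → A₁ × S₁) → ℝ)
    (w : (n : ℕ) → (Fin n → A₂ × S₂) → ℝ) :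
    G.planSum n v w = ∑ k ∈ Finset.range (n + 1), G.planPayoff k v w := by
  simp only [planSum, LinearMap.sum_apply]

lemma continuous_planSum (G : Game A₁ A₂ S₁ S₂) (n : ℕ) :
    Continuous fun p : ((n : ℕ) → (Fin n → A₁ × S₁) → ℝ) × ((n : ℕ) → (Fin n → A₂ × S₂) → ℝ) =>
      G.planSum n p.1 p.2 := by
  simp only [planSum_apply, planPayoff_apply]
  fun_prop

end PlanPayoff

section Play

variable [Finite A₁] [Finite A₂] [Finite S₁] [Finite S₂]
  [MeasurableSpace A₁] [MeasurableSpace A₂] [MeasurableSpace S₁] [MeasurableSpace S₂]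
  [DiscreteMeasurableSpace A₁] [DiscreteMeasurableSpace A₂]
  [DiscreteMeasurableSpace S₁] [DiscreteMeasurableSpace S₂]

instance (G : Game A₁ A₂ S₁ S₂) (σ : Strategy A₁ S₁) (τ : Strategy A₂ S₂) :
    IsProbabilityMeasure (G.playMeasure σ τ) := by
  unfold playMeasure
  infer_instance

instance (G : Game A₁ A₂ S₁ S₂) (σ : Strategy A₁ S₁) (τ : Strategy A₂ S₂) :
    IsProbabilityMeasure (G.historyMeasure σ τ) :=
  Measure.isProbabilityMeasure_map (by fun_prop)

lemma playMeasure_cylinder_succ (G : Game A₁ A₂ S₁ S₂) (σ : Strategy A₁ S₁)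
    (τ : Strategy A₂ S₂) (x : ℕ → (A₁ × S₁) × (A₂ × S₂)) (n : ℕ) :
    G.playMeasure σ τ (PiNat.cylinder x (n + 1)) =
      G.playMeasure σ τ (PiNat.cylinder x n) * G.stageLaw σ τ n (fun i => x i) (x n) := by
  rw [← PMF.toMeasure_apply_singleton _ _ (.singleton _)]
  cases n with
  | zero =>
    rw [PiNat.cylinder_zero, measure_univ, one_mul, playMeasure, trajMeasure_cylinder_one]
    congr!
  | succ n => exact trajMeasure_cylinder_succ_succ _ _ x n

lemma playMeasure_real_cylinder (G : Game A₁ A₂ S₁ S₂) (σ : Strategy A₁ S₁)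
    (τ : Strategy A₂ S₂) (x : ℕ → (A₁ × S₁) × (A₂ × S₂)) (n : ℕ) :
    (G.playMeasure σ τ).real (PiNat.cylinder x n) =
      weight σ n (fun i => (x i).1) * weight τ n (fun i => (x i).2) *
        G.signalWeight n (fun i => x i) := by
  induction n with
  | zero => simp [weight, signalWeight]
  | succ n ih =>
    rw [measureReal_def] at ih ⊢
    rw [playMeasure_cylinder_succ, stageLaw_apply]
    simp only [ENNReal.toReal_mul, ih, weight, signalWeight]
    change _ = weight σ n (fun i => (x i).1) * (σ n (fun i => (x i).1) (x n).1.1).toReal *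
      (weight τ n (fun i => (x i).2) * (τ n (fun i => (x i).2) (x n).2.1).toReal) *
      (G.signalWeight n (fun i => x i) *
        ((G.signal₁ (n + 1) (fun i => actionPair (x i)) (x n).1.2).toReal *
          (G.signal₂ (n + 1) (fun i => actionPair (x i)) (x n).2.2).toReal))
    ring

lemma playMeasure_prefix (G : Game A₁ A₂ S₁ S₂) (σ : Strategy A₁ S₁) (τ : Strategy A₂ S₂)
    (k : ℕ) (z : Fin k → (A₁ × S₁) × (A₂ × S₂)) :
    G.playMeasure σ τ {y | ∀ i : Fin k, y i = z i} = ENNReal.ofReal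
      (weight σ k (fun i => (z i).1) * weight τ k (fun i => (z i).2) * G.signalWeight k z) := by
  have : Nonempty ((A₁ × S₁) × (A₂ × S₂)) :=
    (G.stageLaw σ τ 0 Fin.elim0).support_nonempty.to_type
  obtain ⟨x, rfl⟩ := (Fin.val_injective (n := k)).surjective_comp_right z
  have hcyl : {y : ℕ → (A₁ × S₁) × (A₂ × S₂) | ∀ i : Fin k, y i = x i} = PiNat.cylinder x k := by
    ext y
    exact Fin.forall_iff
  change G.playMeasure σ τ {y | ∀ i : Fin k, y i = x i} = ENNReal.ofReal
    (weight σ k (fun i => (x i).1) * weight τ k (fun i => (x i).2) *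
      G.signalWeight k (fun i => x i))
  rw [hcyl, ← G.playMeasure_real_cylinder σ τ x k, ofReal_measureReal]

lemma expectedPayoff_truncate_mono (G : Game A₁ A₂ S₁ S₂) (σ : Strategy A₁ S₁)
    (τ : Strategy A₂ S₂) : Monotone fun n => (G.truncate n).expectedPayoff σ τ :=
  fun _ _ hmn => lintegral_mono (G.totalPayoff_truncate_mono hmn)

lemma expectedPayoff_eq_iSup_truncate (G : Game A₁ A₂ S₁ S₂) (σ : Strategy A₁ S₁)
    (τ : Strategy A₂ S₂) : G.expectedPayoff σ τ = ⨆ n, (G.truncate n).expectedPayoff σ τ := by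
  rw [expectedPayoff, lintegral_congr G.totalPayoff_eq_iSup_truncate]
  exact lintegral_iSup (fun n => (G.truncate n).measurable_totalPayoff)
    G.totalPayoff_truncate_mono

lemma expectedPayoff_truncate_le (G : Game A₁ A₂ S₁ S₂) (n : ℕ) (σ : Strategy A₁ S₁)
    (τ : Strategy A₂ S₂) : (G.truncate n).expectedPayoff σ τ ≤ G.expectedPayoff σ τ :=
  (le_iSup (fun n => (G.truncate n).expectedPayoff σ τ) n).trans_eq
    (G.expectedPayoff_eq_iSup_truncate σ τ).symm

lemma expectedPayoff_le_of_totalPayoff_le (G : Game A₁ A₂ S₁ S₂) {B : ℝ≥0∞}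
    (hB : ∀ h, G.totalPayoff h ≤ B) (σ : Strategy A₁ S₁) (τ : Strategy A₂ S₂) :
    G.expectedPayoff σ τ ≤ B :=
  (lintegral_mono hB).trans_eq (by simp)

end Play

section PlayPlan

variable [Fintype A₁] [Fintype A₂] [Fintype S₁] [Fintype S₂]
  [MeasurableSpace A₁] [MeasurableSpace A₂] [MeasurableSpace S₁] [MeasurableSpace S₂]
  [DiscreteMeasurableSpace A₁] [DiscreteMeasurableSpace A₂]
  [DiscreteMeasurableSpace S₁] [DiscreteMeasurableSpace S₂]

lemma lintegral_payoff_eq_planPayoff (G : Game A₁ A₂ S₁ S₂) (σ : Strategy A₁ S₁)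
    (τ : Strategy A₂ S₂) (k : ℕ) :
    ∫⁻ h, (G.payoff k (fun i => h i) : ℝ≥0∞) ∂(G.historyMeasure σ τ) =
      ENNReal.ofReal (G.planPayoff k (weight σ) (weight τ)) := by
  rw [historyMeasure, lintegral_map (G.measurable_payoff_prefix k) (by fun_prop)]
  refine (lintegral_prefix (G.playMeasure σ τ) k fun z =>
    (G.payoff k (fun i => actionPair (z i)) : ℝ≥0∞)).trans ?_
  rw [planPayoff_apply, ENNReal.ofReal_sum_of_nonneg]
  · simp_rw [playMeasure_prefix, ENNReal.ofReal_mul (NNReal.coe_nonneg _),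
      ENNReal.ofReal_coe_nnreal]
  · exact fun x _ => mul_nonneg (NNReal.coe_nonneg _) (mul_nonneg
      (mul_nonneg (weight_nonneg _ _ _) (weight_nonneg _ _ _)) (G.signalWeight_nonneg k x))

lemma expectedPayoff_truncate_eq_planSum (G : Game A₁ A₂ S₁ S₂) (n : ℕ) (σ : Strategy A₁ S₁)
    (τ : Strategy A₂ S₂) :
    (G.truncate n).expectedPayoff σ τ = ENNReal.ofReal (G.planSum n (weight σ) (weight τ)) := by
  have hμ : (G.truncate n).historyMeasure σ τ = G.historyMeasure σ τ := rfl
  rw [expectedPayoff, hμ, planSum_apply,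
    ENNReal.ofReal_sum_of_nonneg fun k _ => G.planPayoff_weight_nonneg k σ τ]
  simp_rw [totalPayoff_truncate, ← lintegral_payoff_eq_planPayoff]
  exact lintegral_finsetSum _ fun k _ => G.measurable_payoff_prefix k

end PlayPlan

section Value

variable [Finite A₁] [Finite A₂] [Finite S₁] [Finite S₂]
  [MeasurableSpace A₁] [MeasurableSpace A₂] [MeasurableSpace S₁] [MeasurableSpace S₂]
  [DiscreteMeasurableSpace A₁] [DiscreteMeasurableSpace A₂]
  [DiscreteMeasurableSpace S₁] [DiscreteMeasurableSpace S₂]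

lemma val₁_le_lowerValue (G : Game A₁ A₂ S₁ S₂) (σ : Strategy A₁ S₁) :
    G.val₁ σ ≤ G.lowerValue :=
  le_iSup G.val₁ σ

lemma upperValue_le_val₂ (G : Game A₁ A₂ S₁ S₂) (τ : Strategy A₂ S₂) :
    G.upperValue ≤ G.val₂ τ :=
  iInf_le G.val₂ τ

lemma lowerValue_le_upperValue (G : Game A₁ A₂ S₁ S₂) : G.lowerValue ≤ G.upperValue :=
  iSup_iInf_le_iInf_iSup G.expectedPayoff

lemma isOptimal₂_of_val₂_le_lowerValue {G : Game A₁ A₂ S₁ S₂} {τ : Strategy A₂ S₂}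
    (h : G.val₂ τ ≤ G.lowerValue) : G.IsOptimal₂ τ :=
  ⟨(G.lowerValue_le_upperValue.trans (G.upperValue_le_val₂ τ)).antisymm h,
    (G.upperValue_le_val₂ τ).antisymm (h.trans G.lowerValue_le_upperValue)⟩

lemma IsValue.isEpsOptimal₁ {G : Game A₁ A₂ S₁ S₂} {v : ℝ≥0∞} (hv : G.IsValue v) (hfin : v ≠ ∞)
    {ε : ℝ≥0} (hε : 0 < ε) {σ : Strategy A₁ S₁} (h : v < G.val₁ σ + ε) :
    G.IsEpsOptimal₁ ε σ :=
  ⟨v, hv, ((G.val₁_le_lowerValue σ).trans_eq hv.1).trans_lt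
    (ENNReal.lt_add_right hfin (ENNReal.coe_pos.2 hε).ne'), h⟩

lemma IsValue.isEpsOptimal₂ {G : Game A₁ A₂ S₁ S₂} {v : ℝ≥0∞} (hv : G.IsValue v) (hfin : v ≠ ∞)
    {ε : ℝ≥0} (hε : 0 < ε) {τ : Strategy A₂ S₂} (h : G.val₂ τ < v + ε) :
    G.IsEpsOptimal₂ ε τ :=
  ⟨v, hv, h, (ENNReal.lt_add_right hfin (ENNReal.coe_pos.2 hε).ne').trans_le
    (add_le_add_left (hv.2.symm.trans_le (G.upperValue_le_val₂ τ)) _)⟩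

lemma Bounded.lowerValue_ne_top [Nonempty A₂] {G : Game A₁ A₂ S₁ S₂} (hG : G.Bounded) :
    G.lowerValue ≠ ∞ := by
  obtain ⟨B, hB⟩ := hG
  have hle : G.lowerValue ≤ B := iSup_le fun σ =>
    (iInf_le _ fun _ _ => PMF.pure (Classical.arbitrary A₂)).trans
      (G.expectedPayoff_le_of_totalPayoff_le (fun h => (hB h).le) σ _)
  exact (hle.trans_lt ENNReal.coe_lt_top).ne

lemma val₁_truncate_mono (G : Game A₁ A₂ S₁ S₂) (σ : Strategy A₁ S₁) :
    Monotone fun n => (G.truncate n).val₁ σ :=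
  fun _ _ hmn => iInf_mono fun τ => G.expectedPayoff_truncate_mono σ τ hmn

lemma val₂_truncate_mono (G : Game A₁ A₂ S₁ S₂) (τ : Strategy A₂ S₂) :
    Monotone fun n => (G.truncate n).val₂ τ :=
  fun _ _ hmn => iSup_mono fun σ => G.expectedPayoff_truncate_mono σ τ hmn

lemma lowerValue_truncate_le (G : Game A₁ A₂ S₁ S₂) (n : ℕ) :
    (G.truncate n).lowerValue ≤ G.lowerValue :=
  iSup_mono fun σ => iInf_mono fun τ => G.expectedPayoff_truncate_le n σ τ

lemma val₂_eq_iSup_truncate (G : Game A₁ A₂ S₁ S₂) (τ : Strategy A₂ S₂) :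
    G.val₂ τ = ⨆ n, (G.truncate n).val₂ τ := by
  simp only [val₂, G.expectedPayoff_eq_iSup_truncate]
  exact iSup_comm

lemma exists_forall_val₂_truncate_le [Nonempty A₂] (G : Game A₁ A₂ S₁ S₂) {v : ℝ≥0∞}
    (h : ∀ n, ∃ τ, (G.truncate n).val₂ τ ≤ v) : ∃ τ, ∀ n, (G.truncate n).val₂ τ ≤ v := by
  cases nonempty_fintype A₁
  cases nonempty_fintype A₂
  cases nonempty_fintype S₁
  cases nonempty_fintype S₂
  have : CompactSpace (realizationPlans A₂ S₂) :=
    isCompact_iff_compactSpace.1 isCompact_realizationPlans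
  let F (n : ℕ) (w : realizationPlans A₂ S₂) : ℝ≥0∞ :=
    ⨆ σ : Strategy A₁ S₁, ENNReal.ofReal (G.planSum n (weight σ) w)
  have hF (n : ℕ) (τ : Strategy A₂ S₂) :
      F n ⟨weight τ, weight_mem_realizationPlans τ⟩ = (G.truncate n).val₂ τ :=
    iSup_congr fun σ => (G.expectedPayoff_truncate_eq_planSum n σ τ).symm
  have hmono : Monotone F := by
    rintro m n hmn ⟨w, hw⟩
    obtain ⟨τ, rfl⟩ := exists_weight_eq hw
    simpa only [hF] using G.val₂_truncate_mono τ hmn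
  have hlsc (n : ℕ) : LowerSemicontinuous (F n) := lowerSemicontinuous_iSup fun σ =>
    (ENNReal.continuous_ofReal.comp ((G.continuous_planSum n).comp
      (.prodMk continuous_const continuous_subtype_val))).lowerSemicontinuous
  obtain ⟨⟨w, hw⟩, hle⟩ := exists_forall_le_of_monotone_of_lowerSemicontinuous hmono hlsc
    fun n => (h n).imp' (fun τ => ⟨weight τ, weight_mem_realizationPlans τ⟩) fun τ hτ =>
      (hF n τ).trans_le hτ
  obtain ⟨τ, rfl⟩ := exists_weight_eq hw
  exact ⟨τ, fun n => (hF n τ).symm.trans_le (hle n)⟩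

variable [Nonempty A₁] [Nonempty A₂]

lemma exists_val₂_truncate_le_val₁ (G : Game A₁ A₂ S₁ S₂) (n : ℕ) :
    ∃ σ τ, (G.truncate n).val₂ τ ≤ (G.truncate n).val₁ σ := by
  cases nonempty_fintype A₁
  cases nonempty_fintype A₂
  cases nonempty_fintype S₁
  cases nonempty_fintype S₂
  obtain ⟨w, hw, v, hv, hsaddle⟩ := exists_isSaddlePointOn_of_bilinear
    realizationPlans_nonempty convex_realizationPlans isCompact_realizationPlans
    realizationPlans_nonempty convex_realizationPlans isCompact_realizationPlans
    (G.planSum n).flip (fun v => (G.continuous_planSum n).comp (.prodMk_right v))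
    (fun w => (G.continuous_planSum n).comp (.prodMk_left w))
  obtain ⟨σ, rfl⟩ := exists_weight_eq hv
  obtain ⟨τ, rfl⟩ := exists_weight_eq hw
  refine ⟨σ, τ, iSup_le fun σ' => le_iInf fun τ' => ?_⟩
  simp only [expectedPayoff_truncate_eq_planSum]
  exact ENNReal.ofReal_le_ofReal
    (hsaddle _ (weight_mem_realizationPlans τ') _ (weight_mem_realizationPlans σ'))

lemma exists_optimal_truncate (G : Game A₁ A₂ S₁ S₂) (n : ℕ) :
    ∃ σ τ, (G.truncate n).val₁ σ = (G.truncate n).lowerValue ∧ (G.truncate n).IsOptimal₂ τ := by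
  obtain ⟨σ, τ, h⟩ := G.exists_val₂_truncate_le_val₁ n
  have hτ := isOptimal₂_of_val₂_le_lowerValue (h.trans (val₁_le_lowerValue _ σ))
  exact ⟨σ, τ, (val₁_le_lowerValue _ σ).antisymm (hτ.1.trans_le h), hτ⟩

lemma isValue_truncate (G : Game A₁ A₂ S₁ S₂) (n : ℕ) :
    (G.truncate n).IsValue (G.truncate n).lowerValue := by
  obtain ⟨-, τ, -, hτ⟩ := G.exists_optimal_truncate n
  exact ⟨rfl, hτ.2.trans hτ.1.symm⟩

lemma exists_val₂_le_iSup_lowerValue_truncate (G : Game A₁ A₂ S₁ S₂) :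
    ∃ τ, G.val₂ τ ≤ ⨆ n, (G.truncate n).lowerValue := by
  obtain ⟨τ, hτ⟩ := G.exists_forall_val₂_truncate_le (v := ⨆ n, (G.truncate n).lowerValue)
    fun n => by
      obtain ⟨-, τ, -, hτ⟩ := G.exists_optimal_truncate n
      exact ⟨τ, hτ.1.symm.trans_le (le_iSup (fun n => (G.truncate n).lowerValue) n)⟩
  exact ⟨τ, (G.val₂_eq_iSup_truncate τ).trans_le (iSup_le hτ)⟩

lemma exists_isOptimal₂ (G : Game A₁ A₂ S₁ S₂) : ∃ τ, G.IsOptimal₂ τ :=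
  G.exists_val₂_le_iSup_lowerValue_truncate.imp fun _ hτ =>
    isOptimal₂_of_val₂_le_lowerValue (hτ.trans (iSup_le G.lowerValue_truncate_le))

lemma lowerValue_eq_iSup_truncate (G : Game A₁ A₂ S₁ S₂) :
    G.lowerValue = ⨆ n, (G.truncate n).lowerValue := by
  obtain ⟨τ, hτ⟩ := G.exists_val₂_le_iSup_lowerValue_truncate
  exact (G.lowerValue_le_upperValue.trans ((G.upperValue_le_val₂ τ).trans hτ)).antisymm
    (iSup_le G.lowerValue_truncate_le)

lemma hasUniformValue_of_lowerValue_ne_top (G : Game A₁ A₂ S₁ S₂) (hG : G.lowerValue ≠ ∞) :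
    G.HasUniformValue := by
  obtain ⟨τ, hτ⟩ := G.exists_isOptimal₂
  refine ⟨⟨_, hτ⟩, fun ε hε => ?_⟩
  obtain ⟨N, hN⟩ : ∃ N, G.lowerValue < (G.truncate N).lowerValue + ε := by
    refine lt_iSup_iff.1 ?_
    rw [← ENNReal.iSup_add, ← G.lowerValue_eq_iSup_truncate]
    exact ENNReal.lt_add_right hG (ENNReal.coe_pos.2 hε).ne'
  obtain ⟨σ, -, hσ, -⟩ := G.exists_optimal_truncate N
  refine ⟨N, σ, τ, fun n hn => ?_⟩
  have hfin : (G.truncate n).lowerValue ≠ ∞ := ne_top_of_le_ne_top hG (G.lowerValue_truncate_le n)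
  have hNn : (G.truncate N).lowerValue ≤ (G.truncate n).val₁ σ :=
    hσ.symm.trans_le (G.val₁_truncate_mono σ hn.le)
  constructor
  · refine (G.isValue_truncate n).isEpsOptimal₁ hfin hε ?_
    calc (G.truncate n).lowerValue ≤ G.lowerValue := G.lowerValue_truncate_le n
      _ < (G.truncate N).lowerValue + ε := hN
      _ ≤ (G.truncate n).val₁ σ + ε := by gcongr
  · refine (G.isValue_truncate n).isEpsOptimal₂ hfin hε ?_
    calc (G.truncate n).val₂ τ ≤ G.val₂ τ :=
          iSup_mono fun σ' => G.expectedPayoff_truncate_le n σ' τ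
      _ = G.lowerValue := hτ.1.symm
      _ < (G.truncate N).lowerValue + ε := hN
      _ ≤ (G.truncate n).lowerValue + ε := by gcongr; exact hNn.trans (val₁_le_lowerValue _ σ)

end Value

end Game

end PursuitEvasion

end

theorem theorem1_general {A₁ A₂ S₁ S₂ : Type*}
    [Finite A₁] [Finite A₂] [Finite S₁] [Finite S₂] [Nonempty A₁] [Nonempty A₂]
    [MeasurableSpace A₁] [MeasurableSpace A₂] [MeasurableSpace S₁] [MeasurableSpace S₂]
    [DiscreteMeasurableSpace A₁] [DiscreteMeasurableSpace A₂]
    [DiscreteMeasurableSpace S₁] [DiscreteMeasurableSpace S₂]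
    (G : PursuitEvasion.Game A₁ A₂ S₁ S₂) :
    (G.lowerValue ≠ ∞ → G.HasUniformValue) ∧
      ∃ τ : PursuitEvasion.Strategy A₂ S₂, G.IsOptimal₂ τ :=
  ⟨G.hasUniformValue_of_lowerValue_ne_top, G.exists_isOptimal₂⟩

theorem theorem1 {A₁ A₂ S₁ S₂ : Type*}
    [Finite A₁] [Finite A₂] [Finite S₁] [Finite S₂] [Nonempty A₁] [Nonempty A₂]
    [MeasurableSpace A₁] [MeasurableSpace A₂] [MeasurableSpace S₁] [MeasurableSpace S₂]
    [DiscreteMeasurableSpace A₁] [DiscreteMeasurableSpace A₂]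
    [DiscreteMeasurableSpace S₁] [DiscreteMeasurableSpace S₂]
    (G : PursuitEvasion.Game A₁ A₂ S₁ S₂) (hG : G.Bounded) :
    G.HasUniformValue ∧ ∃ τ : PursuitEvasion.Strategy A₂ S₂, G.IsOptimal₂ τ :=
  (theorem1_general G).imp_left fun huniform => huniform hG.lowerValue_ne_top
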